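/- A quaternionic structure $S=(G,-1,q)$ consists of a multiplicative group $G$ in which every element is its own inverse, a distinguished element $-1\in G$ (possibly $-1=1$; write $-a:=(-1)a$), a set $Q$ with a distinguished element $0$, and a surjective map $q:G\times G\to Q$ such that for all $a,b,c,d\in G$: $q(a,-a)=0$; $q(a,b)=q(b,a)$; $q(a,b)=q(a,c)\iff q(a,bc)=0$; and $q(a,b)=q(c,d)$ if and only if there is $x\in G$ with $q(a,b)=q(a,x)=q(c,x)=q(c,d)$. A form over $S$ is a finite tuple $\varphi=\langle a_1,\dots,a_n\rangle$ of elements of $G$ (with $n\ge 0$); $\varphi\perp\psi$ is concatenation and $\varphi\otimes\langle b_1,\dots,b_m\rangle=b_1\varphi\perp\dots\perp b_m\varphi$. Isometry $\cong$ of forms of equal dimension is defined recursively: $\langle a\rangle\cong\langle b\rangle$ iff $a=b$; $\langle a,b\rangle\cong\langle c,d\rangle$ iff $ab=cd$ and $q(a,b)=q(c,d)$; and for $n>2$, $\langle a_1,\dots,a_n\rangle\cong\langle b_1,\dots,b_n\rangle$ iff there are $a,b\in G$ and a form $\chi$ of dimension $n-2$ with $\langle a_1,a\rangle\cong\langle b_1,b\rangle$,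 $\langle a_2,\dots,a_n\rangle\cong\langle a\rangle\perp\chi$ and $\langle b_2,\dots,b_n\rangle\cong\langle b\rangle\perp\chi$ (the empty form is isometric only to itself). A form is isotropic if it is isometric to $\langle 1,-1\rangle\perp\psi$ for some form $\psi$, and anisotropic otherwise. Every form $\varphi$ is isometric to $\varphi_{\mathrm{an}}\perp k\times\langle1,-1\rangle$ with $\varphi_{\mathrm{an}}$ anisotropic and unique up to isometry, and $\varphi,\psi$ are Witt equivalent if $\varphi_{\mathrm{an}}\cong\psi_{\mathrm{an}}$. The Witt ring $W(S)$ is the set of Witt equivalence classes of forms with addition induced by $\perp$ and multiplication induced by $\otimes$; its fundamental ideal $I$ consists of the classes of even-dimensional forms. Write $\langle\langle a,b\rangle\rangle=\langle 1,-a\rangle\otimes\langle 1,-b\rangle$, and use the same notation for its class in $W(S)$, which lies in $I^2$. The abstract 2-Brauer group $B=B(S)$ is the abelian group generated by the set $Q$ with the relations $q(a,b)\ast q(a,c)=q(a,bc)$ for $a,b,c\in G$ as its sole relations. **Theorem.** For every quaternionic structure $S$ there is a group isomorphism $I^2/I^3\to B$ which sends $\langle\langle a,b\rangle\rangle+I^3$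 to $q(a,b)$ for all $a,b\in G$. -/

import Mathlib

/-- A quaternionic structure `(G, -1, q)`: a multiplicative boolean group `G` (every element is its
own inverse) with a distinguished element `negOne`, a set `Q` of quaternions with a distinguished
element `0`, and a surjective map `q : G × G → Q` subject to the four axioms below. -/
structure QuaternionicStructure (G : Type*) (Q : Type*) [CommGroup G] [Zero Q] where
  mul_self : ∀ a : G, a * a = 1
  negOne : G
  q : G → G → Q
  q_surjective : Function.Surjective (fun p : G × G => q p.1 p.2)
  q_neg_self : ∀ a : G, q a (negOne * a) = 0
  q_comm : ∀ a b : G, q a b = q b a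
  q_eq_iff : ∀ a b c : G, q a b = q a c ↔ q a (b * c) = 0
  q_linked : ∀ a b c d : G,
    q a b = q c d ↔ ∃ x : G, q a b = q a x ∧ q a x = q c x ∧ q c x = q c d

namespace QuaternionicStructure

section

universe u v

variable {G : Type u} {Q : Type v} [CommGroup G] [Zero Q] (S : QuaternionicStructure G Q)

/-! ### Quadratic forms and isometry -/

/-- Quadratic forms `⟨a₁, …, aₙ⟩` over `S` are lists of elements of `G` (the empty list being the
form of dimension `0`), and the orthogonal sum is concatenation `++`. Isometry of forms is defined
by recursion on the dimension. -/
inductive Isometric : List G → List G → Prop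
  | nil : Isometric [] []
  | single (a : G) : Isometric [a] [a]
  | pair {a b c d : G} (hdet : a * b = c * d) (hq : S.q a b = S.q c d) : Isometric [a, b] [c, d]
  | step {a₁ b₁ a b : G} {φ ψ χ : List G} (hdim : 2 ≤ φ.length)
      (h₀ : Isometric [a₁, a] [b₁, b]) (h₁ : Isometric φ (a :: χ)) (h₂ : Isometric ψ (b :: χ)) :
      Isometric (a₁ :: φ) (b₁ :: ψ)

/-- The scaled form `c φ`. -/
def scale (c : G) (φ : List G) : List G := φ.map (fun a => c * a)

/-- The tensor product `φ ⊗ ψ = b₁ φ ⊥ … ⊥ bₘ φ`, where `ψ = ⟨b₁, …, bₘ⟩`. -/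
def tensor (φ ψ : List G) : List G := ψ.flatMap (fun b => scale b φ)

/-- The hyperbolic plane `⟨1, -1⟩`. -/
def hyperbolicPlane : List G := [1, S.negOne]

/-- The `k`-fold orthogonal sum of hyperbolic planes. -/
def hyperbolic : ℕ → List G
  | 0 => []
  | k + 1 => S.hyperbolicPlane ++ hyperbolic k

/-- A form is isotropic if it is isometric to a form `⟨1, -1⟩ ⊥ ψ`. -/
def IsIsotropic (φ : List G) : Prop := ∃ ψ : List G, S.Isometric φ (S.hyperbolicPlane ++ ψ)

/-- `α` is an anisotropic part of `φ`: it is anisotropic, and `φ` is isometric to `α ⊥ k × ⟨1, -1⟩`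
for some `k`. -/
def IsAnisotropicPart (φ α : List G) : Prop :=
  ¬ S.IsIsotropic α ∧ ∃ k : ℕ, S.Isometric φ (α ++ S.hyperbolic k)

/-- Witt equivalence: the anisotropic parts are isometric. -/
def WittEquiv (φ ψ : List G) : Prop :=
  ∃ α β : List G, S.IsAnisotropicPart φ α ∧ S.IsAnisotropicPart ψ β ∧ S.Isometric α β

/-- The `n`-fold Pfister form `⟨⟨a₁, …, aₙ⟩⟩ = ⟨1, -a₁⟩ ⊗ … ⊗ ⟨1, -aₙ⟩`. -/
def pfister (l : List G) : List G := l.foldr (fun a φ => tensor [1, S.negOne * a] φ) [1]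

/-! ### Basic facts on `q` -/

theorem mul_self_left (T : QuaternionicStructure G Q) (a b : G) : a * (a * b) = b := by
  rw [← mul_assoc, T.mul_self, one_mul]

theorem q_one (a : G) : S.q a 1 = 0 := by
  have h := (S.q_eq_iff a 1 1).1 rfl
  rwa [one_mul] at h

theorem q_mul_zero {a b c : G} (hb : S.q a b = 0) (hc : S.q a c = 0) : S.q a (b * c) = 0 :=
  (S.q_eq_iff a b c).1 (hb.trans hc.symm)

theorem pair_cond_iff {a b c d : G} :
    (a * b = c * d ∧ S.q a b = S.q c d) ↔
      (a * b = c * d ∧ S.q (S.negOne * (a * b)) (a * c) = 0) := by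
  refine and_congr_right fun h => ?_
  have key : ∀ x y : G, S.q x y = S.q (S.negOne * (x * y)) x := by
    intro x y
    rw [S.q_comm _ x, S.q_eq_iff]
    have : y * (S.negOne * (x * y)) = S.negOne * x := by
      rw [mul_comm x y, mul_left_comm S.negOne y x, S.mul_self_left]
    rw [this, S.q_neg_self]
  rw [key a b, key c d, ← h, S.q_eq_iff]

/-! ### Isometry is an equivalence relation compatible with sums and scaling -/

variable {S}

namespace Isometric

theorem length_eq {φ ψ : List G} (h : S.Isometric φ ψ) : φ.length = ψ.length := by
  induction h with
  | nil => rfl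
  | single a => rfl
  | pair _ _ => rfl
  | step _ _ _ _ _ ih₁ ih₂ => simp only [List.length_cons] at *; omega

theorem symm {φ ψ : List G} (h : S.Isometric φ ψ) : S.Isometric ψ φ := by
  induction h with
  | nil => exact nil
  | single a => exact single a
  | pair h₁ h₂ => exact pair h₁.symm h₂.symm
  | step hd _ h₁ h₂ ih₀ _ _ =>
    refine step ?_ ih₀ h₂ h₁
    have e₁ := h₁.length_eq
    have e₂ := h₂.length_eq
    simp only [List.length_cons] at *
    omega

theorem single_iff {a b : G} : S.Isometric [a] [b] ↔ a = b := by
  constructor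
  · intro h
    cases h with
    | single => rfl
    | step hd => simp at hd
  · rintro rfl
    exact single a

theorem pair_iff {a b c d : G} :
    S.Isometric [a, b] [c, d] ↔ (a * b = c * d ∧ S.q a b = S.q c d) := by
  constructor
  · intro h
    cases h with
    | pair h₁ h₂ => exact ⟨h₁, h₂⟩
    | step hd => simp at hd
  · exact fun h => pair h.1 h.2

theorem pair_iff_zero {a b c d : G} :
    S.Isometric [a, b] [c, d] ↔ (a * b = c * d ∧ S.q (S.negOne * (a * b)) (a * c) = 0) := by
  rw [pair_iff, S.pair_cond_iff]

theorem step_gen {a₁ b₁ a b : G} {φ ψ χ : List G}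
    (h₀ : S.Isometric [a₁, a] [b₁, b]) (h₁ : S.Isometric φ (a :: χ))
    (h₂ : S.Isometric ψ (b :: χ)) : S.Isometric (a₁ :: φ) (b₁ :: ψ) := by
  by_cases hd : 2 ≤ φ.length
  · exact step hd h₀ h₁ h₂
  · have e₁ := h₁.length_eq
    have e₂ := h₂.length_eq
    simp only [List.length_cons] at e₁ e₂
    have hχ : χ = [] := List.length_eq_zero_iff.1 (by omega)
    subst hχ
    obtain ⟨x, rfl⟩ := List.length_eq_one_iff.1 (by simpa using e₁)
    obtain ⟨y, rfl⟩ := List.length_eq_one_iff.1 (by simpa using e₂)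
    rw [single_iff] at h₁ h₂
    subst h₁ h₂
    exact h₀

theorem inv {a₁ b₁ : G} {φ ψ : List G} (h : S.Isometric (a₁ :: φ) (b₁ :: ψ)) (hφ : φ ≠ []) :
    ∃ (a b : G) (χ : List G), S.Isometric [a₁, a] [b₁, b] ∧ S.Isometric φ (a :: χ) ∧
      S.Isometric ψ (b :: χ) := by
  cases h with
  | single => exact absurd rfl hφ
  | pair h₁ h₂ => exact ⟨_, _, [], pair h₁ h₂, single _, single _⟩
  | step _ h₀ h₁ h₂ => exact ⟨_, _, _, h₀, h₁, h₂⟩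

theorem refl : ∀ φ : List G, S.Isometric φ φ
  | [] => nil
  | [_] => single _
  | _ :: b :: φ => step_gen (pair rfl rfl) (refl (b :: φ)) (refl (b :: φ))

theorem cons_congr (a : G) {φ ψ : List G} (h : S.Isometric φ ψ) :
    S.Isometric (a :: φ) (a :: ψ) := by
  cases ψ with
  | nil =>
    have : φ = [] := List.length_eq_zero_iff.1 (by simpa using h.length_eq)
    subst this
    exact single a
  | cons b ψ => exact step_gen (refl [a, b]) h (refl _)

theorem pair_append {a b c d : G} (h : S.Isometric [a, b] [c, d]) (χ : List G) :
    S.Isometric (a :: b :: χ) (c :: d :: χ) :=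
  step_gen h (refl _) (refl _)

theorem triple_trans {a₁ a x b₁ b b' y c₁ c' : G}
    (h₁ : S.Isometric [a₁, a] [b₁, b]) (h₂ : S.Isometric [b, x] [b', y])
    (h₃ : S.Isometric [b₁, b'] [c₁, c']) :
    ∃ a'' c'' z : G, S.Isometric [a₁, a''] [c₁, c''] ∧ S.Isometric [a, x] [a'', z] ∧
      S.Isometric [c', y] [c'', z] := by
  have inv_eq : ∀ {s t s' t' r : G}, S.Isometric [s, t] [s', t'] →
      S.q (S.negOne * (t * r)) (S.negOne * (s * r)) =
        S.q (S.negOne * (t' * r)) (S.negOne * (s' * r)) := by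
    intro s t s' t' r h
    obtain ⟨hd, hz⟩ := pair_iff_zero.1 h
    have key : ∀ u v : G, S.q (S.negOne * (v * r)) (S.negOne * (u * r)) =
        S.q (S.negOne * (u * v)) (S.negOne * (u * r)) := by
      intro u v
      rw [S.q_comm _ (S.negOne * (u * r)), S.q_comm _ (S.negOne * (u * r)), S.q_eq_iff]
      have : S.negOne * (v * r) * (S.negOne * (u * v)) = S.negOne * (S.negOne * (u * r)) := by
        simp only [mul_comm, mul_left_comm, S.mul_self_left]
      rw [this, S.q_neg_self]
    rw [key s t, key s' t', ← hd, S.q_eq_iff]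
    have : S.negOne * (s * r) * (S.negOne * (s' * r)) = s * s' := by
      simp only [mul_comm, mul_left_comm, S.mul_self, mul_one]
    rw [this, hz]
  have d₁ := (pair_iff.1 h₁).1
  have d₂ := (pair_iff.1 h₂).1
  have d₃ := (pair_iff.1 h₃).1
  have e₁ := inv_eq (r := x) h₁
  have e₂ : S.q (S.negOne * (b * x)) (S.negOne * (b₁ * x)) =
      S.q (S.negOne * (b' * y)) (S.negOne * (b₁ * y)) := by
    have key : ∀ u v : G, S.q (S.negOne * (u * v)) (S.negOne * (b₁ * v)) =
        S.q (S.negOne * (v * b₁)) (S.negOne * (u * b₁)) := by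
      intro u v
      rw [S.q_comm, mul_comm b₁ v, S.q_eq_iff]
      have : S.negOne * (u * v) * (S.negOne * (u * b₁)) =
          S.negOne * (S.negOne * (v * b₁)) := by
        simp only [mul_comm, mul_left_comm, S.mul_self_left]
      rw [this, S.q_neg_self]
    rw [key b x, key b' y]
    exact inv_eq (r := b₁) h₂
  have e₃ := inv_eq (r := y) h₃
  have e := e₁.trans (e₂.trans e₃)
  obtain ⟨w, hw₁, hw₂, hw₃⟩ := (S.q_linked _ _ _ _).1 e
  have hdet : a₁ * (a * x) = c₁ * (c' * y) := by
    rw [← mul_assoc, d₁, mul_assoc, d₂, ← mul_assoc, d₃, mul_assoc]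
  rw [S.q_eq_iff] at hw₁
  have hw₃' := (S.q_eq_iff _ _ _).1 hw₃
  rw [S.q_comm, S.q_comm _ w, S.q_eq_iff] at hw₂
  refine ⟨S.negOne * (a₁ * w), S.negOne * (c₁ * w), S.negOne * (a₁ * (a * x) * w), ?_, ?_, ?_⟩
  · rw [pair_iff_zero]
    refine ⟨by simp only [mul_left_comm _ S.negOne, S.mul_self_left], ?_⟩
    have h1 : S.negOne * (a₁ * (S.negOne * (a₁ * w))) = w := by
      simp only [mul_left_comm _ S.negOne, S.mul_self_left]
    have h2 : S.negOne * (a * x) * (S.negOne * (c' * y)) = a₁ * c₁ := by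
      have h3 : a * x = a₁ * (c₁ * (c' * y)) := by rw [← hdet, S.mul_self_left]
      rw [h3]
      simp only [mul_comm, mul_left_comm, S.mul_self_left, S.mul_self, mul_one]
    rw [h1, ← h2]
    exact hw₂
  · rw [pair_iff_zero]
    refine ⟨?_, ?_⟩
    · simp only [mul_comm, mul_left_comm, S.mul_self_left, S.mul_self, mul_one]
    · have h1 : a * (S.negOne * (a₁ * w)) =
          S.negOne * (S.negOne * (a * x)) * (S.negOne * (a₁ * x) * w) := by
        simp only [mul_comm, mul_left_comm, S.mul_self_left, S.mul_self, mul_one]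
      rw [h1]
      exact S.q_mul_zero (S.q_neg_self _) hw₁
  · rw [pair_iff_zero, hdet]
    refine ⟨?_, ?_⟩
    · simp only [mul_comm, mul_left_comm, S.mul_self_left, S.mul_self, mul_one]
    · have h1 : c' * (S.negOne * (c₁ * w)) =
          S.negOne * (S.negOne * (c' * y)) * (w * (S.negOne * (c₁ * y))) := by
        simp only [mul_comm, mul_left_comm, S.mul_self_left, S.mul_self, mul_one]
      rw [h1]
      exact S.q_mul_zero (S.q_neg_self _) hw₃'

theorem trans_aux (n : ℕ) : ∀ {φ ψ θ : List G}, φ.length = n → S.Isometric φ ψ →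
    S.Isometric ψ θ → S.Isometric φ θ := by
  induction n with
  | zero =>
    intro φ ψ θ hn h₁ h₂
    have e₁ := h₁.length_eq
    have e₂ := h₂.length_eq
    have hφ : φ = [] := List.length_eq_zero_iff.1 hn
    have hθ : θ = [] := List.length_eq_zero_iff.1 (by omega)
    subst hφ hθ
    exact nil
  | succ n ih =>
    intro φ ψ θ hn h₁ h₂
    have l₁ := h₁.length_eq
    have l₂ := h₂.length_eq
    match φ, ψ, θ with
    | [], _, _ => simp at hn
    | _ :: _, [], _ => simp at l₁
    | _ :: _, _ :: _, [] => simp at l₂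
    | a₁ :: φ, b₁ :: ψ, c₁ :: θ =>
      simp only [List.length_cons, Nat.add_right_cancel_iff] at hn l₁ l₂
      by_cases hφ : φ = []
      · subst hφ
        have hψ : ψ = [] := List.length_eq_zero_iff.1 (by simpa using l₁.symm)
        subst hψ
        have hθ : θ = [] := List.length_eq_zero_iff.1 (by simpa using l₂.symm)
        subst hθ
        rw [single_iff] at *
        exact h₁.trans h₂
      · have hψ : ψ ≠ [] := by
          rintro rfl
          exact hφ (List.length_eq_zero_iff.1 (by simpa using l₁))
        obtain ⟨a, b, χ, i₀, i₁, i₂⟩ := h₁.inv hφ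
        obtain ⟨b', c', ω, j₀, j₁, j₂⟩ := h₂.inv hψ
        have m₁ := i₁.length_eq
        have m₂ := j₂.length_eq
        have m₃ := i₂.length_eq
        have m₄ := j₁.length_eq
        simp only [List.length_cons] at m₁ m₂ m₃ m₄
        have k : S.Isometric (b :: χ) (b' :: ω) :=
          ih (by simp only [List.length_cons]; omega) i₂.symm j₁
        by_cases hχ : χ = []
        · subst hχ
          have hω : ω = [] := List.length_eq_zero_iff.1 (by simp at m₃; omega)
          subst hω
          rw [single_iff] at k
          subst k
          obtain ⟨d₁, q₁⟩ := pair_iff.1 i₀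
          obtain ⟨d₂, q₂⟩ := pair_iff.1 j₀
          exact step_gen (pair (d₁.trans d₂) (q₁.trans q₂)) i₁ j₂
        · obtain ⟨e, e', ρ, k₀, k₁, k₂⟩ := k.inv hχ
          obtain ⟨a'', c'', z, t₀, t₁, t₂⟩ := triple_trans i₀ k₀ j₀
          refine step_gen (χ := z :: ρ) t₀ ?_ ?_
          · refine ih hn i₁ (ih (by simp only [List.length_cons]; omega) (cons_congr a k₁) ?_)
            exact pair_append t₁ ρ
          · refine ih (by omega) j₂
              (ih (by simp only [List.length_cons]; omega) (cons_congr c' k₂) ?_)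
            exact pair_append t₂ ρ

theorem trans {φ ψ θ : List G} (h₁ : S.Isometric φ ψ) (h₂ : S.Isometric ψ θ) :
    S.Isometric φ θ := trans_aux _ rfl h₁ h₂

theorem of_perm {φ ψ : List G} (h : φ.Perm ψ) : S.Isometric φ ψ := by
  induction h with
  | nil => exact nil
  | cons x _ ih => exact cons_congr x ih
  | swap x y l => exact pair_append (pair (mul_comm _ _) (S.q_comm _ _)) l
  | trans _ _ ih₁ ih₂ => exact ih₁.trans ih₂

theorem append_left (χ : List G) {φ ψ : List G} (h : S.Isometric φ ψ) :
    S.Isometric (χ ++ φ) (χ ++ ψ) := by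
  induction χ with
  | nil => exact h
  | cons a χ ih => exact cons_congr a ih

theorem append {φ φ' ψ ψ' : List G} (h : S.Isometric φ φ') (h' : S.Isometric ψ ψ') :
    S.Isometric (φ ++ ψ) (φ' ++ ψ') :=
  (append_left φ h').trans ((of_perm List.perm_append_comm).trans
    ((append_left ψ' h).trans (of_perm List.perm_append_comm)))

theorem cons_cancel {a : G} {φ ψ : List G} (h : S.Isometric (a :: φ) (a :: ψ)) :
    S.Isometric φ ψ := by
  by_cases hφ : φ = []
  · subst hφ
    have : ψ = [] := List.length_eq_zero_iff.1 (by simpa using h.length_eq.symm)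
    subst this
    exact nil
  · obtain ⟨x, y, χ, h₀, h₁, h₂⟩ := h.inv hφ
    have hxy : x = y := mul_left_cancel (pair_iff.1 h₀).1
    subst hxy
    exact h₁.trans h₂.symm

theorem append_cancel {χ φ ψ : List G} (h : S.Isometric (φ ++ χ) (ψ ++ χ)) :
    S.Isometric φ ψ := by
  have h' : S.Isometric (χ ++ φ) (χ ++ ψ) :=
    (of_perm List.perm_append_comm).trans (h.trans (of_perm List.perm_append_comm))
  clear h
  induction χ with
  | nil => exact h'
  | cons a χ ih => exact ih (cons_cancel h')

theorem scale (c : G) {φ ψ : List G} (h : S.Isometric φ ψ) :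
    S.Isometric (scale c φ) (QuaternionicStructure.scale c ψ) := by
  induction h with
  | nil => exact nil
  | single a => exact single _
  | @pair x y x' y' hd hq =>
    have h0 := pair_iff_zero.1 (pair hd hq)
    refine pair_iff_zero.2 ?_
    have e : ∀ s t : G, c * s * (c * t) = s * t := fun s t => by
      rw [mul_mul_mul_comm, S.mul_self, one_mul]
    rw [e, e, e]
    exact h0
  | step _ _ _ _ ih₀ ih₁ ih₂ => exact step_gen ih₀ ih₁ ih₂

theorem tensor_left {φ φ' : List G} (h : S.Isometric φ φ') (ψ : List G) :
    S.Isometric (tensor φ ψ) (tensor φ' ψ) := by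
  induction ψ with
  | nil => exact nil
  | cons b ψ ih => exact append (h.scale b) ih

end Isometric

/-! ### The Witt ring -/

theorem hyperbolic_add (k l : ℕ) : S.hyperbolic (k + l) = S.hyperbolic k ++ S.hyperbolic l := by
  induction k with
  | zero => simp [hyperbolic]
  | succ k ih => rw [Nat.add_right_comm]; simp [hyperbolic, ih]

theorem length_hyperbolic (k : ℕ) : (S.hyperbolic k).length = 2 * k := by
  induction k with
  | zero => rfl
  | succ k ih => simp only [hyperbolic, hyperbolicPlane, List.length_append, ih, List.length_cons,
      List.length_nil]; omega

variable (S) in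
theorem exists_anisotropicPart (φ : List G) : ∃ α, S.IsAnisotropicPart φ α := by
  induction h : φ.length using Nat.strong_induction_on generalizing φ with
  | _ n ih =>
    by_cases hφ : S.IsIsotropic φ
    · obtain ⟨ψ, hψ⟩ := hφ
      have hl := hψ.length_eq
      simp only [hyperbolicPlane, List.length_append, List.length_cons, List.length_nil] at hl
      obtain ⟨α, hα, k, hk⟩ := ih ψ.length (by omega) ψ rfl
      refine ⟨α, hα, k + 1, hψ.trans ((Isometric.append_left _ hk).trans (Isometric.of_perm ?_))⟩
      exact List.perm_append_comm_assoc _ _ _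
    · exact ⟨φ, hφ, 0, by simpa [hyperbolic] using Isometric.refl φ⟩

theorem anisotropicPart_unique {α β : List G} {k l : ℕ} (hα : ¬ S.IsIsotropic α)
    (hβ : ¬ S.IsIsotropic β) (h : S.Isometric (α ++ S.hyperbolic k) (β ++ S.hyperbolic l)) :
    S.Isometric α β := by
  have aux : ∀ {α β : List G} {k m : ℕ}, ¬ S.IsIsotropic α →
      S.Isometric (α ++ S.hyperbolic k) (β ++ S.hyperbolic (m + k)) → S.Isometric α β := by
    intro α β k m hα h
    rw [hyperbolic_add, ← List.append_assoc] at h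
    have h' := Isometric.append_cancel h
    cases m with
    | zero => simpa [hyperbolic] using h'
    | succ m =>
      exact absurd ⟨β ++ S.hyperbolic m,
        h'.trans (Isometric.of_perm (List.perm_append_comm_assoc _ _ _))⟩ hα
  rcases le_total k l with hkl | hkl
  · obtain ⟨m, rfl⟩ := Nat.exists_eq_add_of_le' hkl
    exact aux hα h
  · obtain ⟨m, rfl⟩ := Nat.exists_eq_add_of_le' hkl
    exact (aux hβ h.symm).symm

/-- Two forms are Witt equivalent if and only if they become isometric after adding hyperbolic
planes. -/
theorem wittEquiv_iff {φ ψ : List G} :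
    S.WittEquiv φ ψ ↔ ∃ k l : ℕ, S.Isometric (φ ++ S.hyperbolic k) (ψ ++ S.hyperbolic l) := by
  constructor
  · rintro ⟨α, β, ⟨_, k, hk⟩, ⟨_, l, hl⟩, h⟩
    refine ⟨l, k, ?_⟩
    refine (Isometric.append hk (Isometric.refl _)).trans
      (Isometric.trans ?_ (Isometric.append hl.symm (Isometric.refl _)))
    rw [List.append_assoc, List.append_assoc, ← hyperbolic_add, ← hyperbolic_add, add_comm l k]
    exact Isometric.append h (Isometric.refl _)
  · rintro ⟨k, l, h⟩
    obtain ⟨α, hα, m, hm⟩ := S.exists_anisotropicPart φ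
    obtain ⟨β, hβ, n, hn⟩ := S.exists_anisotropicPart ψ
    refine ⟨α, β, ⟨hα, m, hm⟩, ⟨hβ, n, hn⟩, anisotropicPart_unique (k := m + k) (l := n + l) hα hβ ?_⟩
    rw [hyperbolic_add, hyperbolic_add, ← List.append_assoc, ← List.append_assoc]
    exact (Isometric.append hm.symm (Isometric.refl _)).trans
      (h.trans (Isometric.append hn (Isometric.refl _)))

theorem WittEquiv.of_isometric {φ ψ : List G} (h : S.Isometric φ ψ) : S.WittEquiv φ ψ :=
  wittEquiv_iff.2 ⟨0, 0, Isometric.append h (Isometric.refl _)⟩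

theorem WittEquiv.of_perm {φ ψ : List G} (h : φ.Perm ψ) : S.WittEquiv φ ψ :=
  WittEquiv.of_isometric (Isometric.of_perm h)

theorem WittEquiv.symm {φ ψ : List G} (h : S.WittEquiv φ ψ) : S.WittEquiv ψ φ := by
  obtain ⟨k, l, h⟩ := wittEquiv_iff.1 h
  exact wittEquiv_iff.2 ⟨l, k, h.symm⟩

theorem WittEquiv.trans {φ ψ θ : List G} (h₁ : S.WittEquiv φ ψ) (h₂ : S.WittEquiv ψ θ) :
    S.WittEquiv φ θ := by
  obtain ⟨k, l, h₁⟩ := wittEquiv_iff.1 h₁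
  obtain ⟨m, n, h₂⟩ := wittEquiv_iff.1 h₂
  refine wittEquiv_iff.2 ⟨k + m, n + l, ?_⟩
  rw [hyperbolic_add, hyperbolic_add, ← List.append_assoc, ← List.append_assoc]
  refine (Isometric.append h₁ (Isometric.refl _)).trans
    (Isometric.trans ?_ (Isometric.append h₂ (Isometric.refl _)))
  rw [List.append_assoc, List.append_assoc]
  exact Isometric.append_left _ (Isometric.of_perm List.perm_append_comm)

theorem WittEquiv.append {φ φ' ψ ψ' : List G} (h₁ : S.WittEquiv φ φ') (h₂ : S.WittEquiv ψ ψ') :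
    S.WittEquiv (φ ++ ψ) (φ' ++ ψ') := by
  obtain ⟨k, l, h₁⟩ := wittEquiv_iff.1 h₁
  obtain ⟨m, n, h₂⟩ := wittEquiv_iff.1 h₂
  have p : ∀ a b c d : List G, S.Isometric ((a ++ b) ++ (c ++ d)) ((a ++ c) ++ (b ++ d)) := by
    intro a b c d
    simp only [List.append_assoc]
    exact Isometric.append_left _ (Isometric.of_perm (List.perm_append_comm_assoc _ _ _))
  refine wittEquiv_iff.2 ⟨k + m, l + n, ?_⟩
  rw [hyperbolic_add, hyperbolic_add]
  exact (p _ _ _ _).trans ((Isometric.append h₁ h₂).trans (p _ _ _ _))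

theorem isometric_scale_hyperbolicPlane (c : G) :
    S.Isometric (scale c S.hyperbolicPlane) S.hyperbolicPlane := by
  refine Isometric.pair ?_ ?_
  · change c * 1 * (c * S.negOne) = 1 * S.negOne
    rw [mul_one, one_mul, S.mul_self_left]
  · change S.q (c * 1) (c * S.negOne) = S.q 1 S.negOne
    rw [mul_one, mul_comm c, S.q_neg_self, S.q_comm, S.q_one]

theorem isometric_scale_hyperbolic (c : G) (k : ℕ) :
    S.Isometric (scale c (S.hyperbolic k)) (S.hyperbolic k) := by
  induction k with
  | zero => exact Isometric.nil
  | succ k ih =>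
    have : scale c (S.hyperbolic (k + 1)) =
        scale c S.hyperbolicPlane ++ scale c (S.hyperbolic k) := List.map_append
    rw [this]
    exact Isometric.append (isometric_scale_hyperbolicPlane c) ih

theorem WittEquiv.scale (c : G) {φ ψ : List G} (h : S.WittEquiv φ ψ) :
    S.WittEquiv (scale c φ) (QuaternionicStructure.scale c ψ) := by
  obtain ⟨k, l, h⟩ := wittEquiv_iff.1 h
  refine wittEquiv_iff.2 ⟨k, l, ?_⟩
  have h' := h.scale c
  simp only [QuaternionicStructure.scale, List.map_append] at h' ⊢
  exact (Isometric.append_left _ (isometric_scale_hyperbolic c k).symm).trans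
    (h'.trans (Isometric.append_left _ (isometric_scale_hyperbolic c l)))

theorem scale_one (φ : List G) : scale 1 φ = φ := by simp [scale]

theorem scale_scale (b c : G) (φ : List G) : scale b (scale c φ) = scale (b * c) φ := by
  simp [scale, mul_assoc]

theorem tensor_append (φ ψ θ : List G) : tensor φ (ψ ++ θ) = tensor φ ψ ++ tensor φ θ :=
  List.flatMap_append

theorem scale_tensor (c : G) (φ ψ : List G) : scale c (tensor φ ψ) = tensor φ (scale c ψ) := by
  simp [scale, tensor, List.map_flatMap, List.flatMap_map, mul_assoc]

theorem tensor_assoc (φ ψ θ : List G) :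
    tensor (tensor φ ψ) θ = tensor φ (tensor ψ θ) := by
  induction θ with
  | nil => rfl
  | cons c θ ih =>
    have h₁ : ∀ α : List G, tensor α (c :: θ) = scale c α ++ tensor α θ := fun _ => rfl
    rw [h₁, h₁, ih, tensor_append, scale_tensor]

theorem tensor_comm_perm (φ ψ : List G) : (tensor φ ψ).Perm (tensor ψ φ) := by
  induction φ with
  | nil => simp [tensor, scale]
  | cons a φ ih =>
    have h₁ : tensor ψ (a :: φ) = scale a ψ ++ tensor ψ φ := rfl
    have h₂ : (tensor (a :: φ) ψ).Perm (scale a ψ ++ tensor φ ψ) := by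
      clear ih h₁
      induction ψ with
      | nil => simp [tensor, scale]
      | cons b ψ ih =>
        have e₁ : tensor (a :: φ) (b :: ψ) = b * a :: (scale b φ ++ tensor (a :: φ) ψ) := rfl
        have e₂ : scale a (b :: ψ) ++ tensor φ (b :: ψ) =
          a * b :: (scale a ψ ++ (scale b φ ++ tensor φ ψ)) := rfl
        rw [e₁, e₂, mul_comm b a]
        exact ((ih.append_left _).trans (List.perm_append_comm_assoc _ _ _)).cons _
    rw [h₁]
    exact h₂.trans (ih.append_left _)

theorem length_tensor (φ ψ : List G) : (tensor φ ψ).length = φ.length * ψ.length := by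
  induction ψ with
  | nil => rfl
  | cons b ψ ih =>
    have h₁ : tensor φ (b :: ψ) = scale b φ ++ tensor φ ψ := rfl
    rw [h₁, List.length_append, ih, List.length_cons, scale, List.length_map]
    ring

theorem WittEquiv.tensor_left {φ φ' : List G} (h : S.WittEquiv φ φ') (ψ : List G) :
    S.WittEquiv (tensor φ ψ) (tensor φ' ψ) := by
  induction ψ with
  | nil => exact WittEquiv.of_isometric Isometric.nil
  | cons b ψ ih => exact WittEquiv.append (h.scale b) ih

theorem WittEquiv.tensor {φ φ' ψ ψ' : List G} (h₁ : S.WittEquiv φ φ') (h₂ : S.WittEquiv ψ ψ') :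
    S.WittEquiv (tensor φ ψ) (QuaternionicStructure.tensor φ' ψ') :=
  (h₁.tensor_left ψ).trans ((WittEquiv.of_perm (tensor_comm_perm _ _)).trans
    ((h₂.tensor_left φ').trans (WittEquiv.of_perm (tensor_comm_perm _ _))))

theorem WittEquiv.neg_append (φ : List G) :
    S.WittEquiv (QuaternionicStructure.scale S.negOne φ ++ φ) [] := by
  induction φ with
  | nil => exact WittEquiv.of_isometric Isometric.nil
  | cons a φ ih =>
    have h : S.WittEquiv [S.negOne * a, a] [] := by
      refine wittEquiv_iff.2 ⟨0, 1, ?_⟩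
      refine Isometric.pair ?_ ?_
      · rw [mul_assoc, S.mul_self, mul_one, one_mul]
      · rw [S.q_comm, S.q_neg_self, S.q_comm, S.q_one]
    refine WittEquiv.trans (WittEquiv.of_perm ?_) (WittEquiv.append h ih)
    exact List.Perm.cons _ List.perm_middle

variable (S)

/-- Witt equivalence as a setoid on forms. -/
def wittSetoid : Setoid (List G) where
  r := S.WittEquiv
  iseqv := ⟨fun φ => WittEquiv.of_isometric (Isometric.refl φ), WittEquiv.symm, WittEquiv.trans⟩

/-- The Witt ring `W(S)`: the set of Witt equivalence classes of forms over `S`. -/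
def WittRing : Type u := Quotient S.wittSetoid

/-- The class of a form in the Witt ring. -/
def wittClass (φ : List G) : S.WittRing := Quotient.mk S.wittSetoid φ

variable {S}

theorem wittClass_eq_iff {φ ψ : List G} : S.wittClass φ = S.wittClass ψ ↔ S.WittEquiv φ ψ :=
  Quotient.eq (r := S.wittSetoid)

/-- The zero of the Witt ring is the class of the empty form. -/
instance : Zero S.WittRing := ⟨S.wittClass []⟩

/-- The one of the Witt ring is the class of `⟨1⟩`. -/
instance : One S.WittRing := ⟨S.wittClass [1]⟩

/-- Addition in the Witt ring is induced by the orthogonal sum. -/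
instance : Add S.WittRing :=
  ⟨Quotient.map₂ (fun φ ψ => φ ++ ψ) (fun _ _ h₁ _ _ h₂ => WittEquiv.append h₁ h₂)⟩

/-- Multiplication in the Witt ring is induced by the tensor product. -/
instance : Mul S.WittRing :=
  ⟨Quotient.map₂ tensor (fun _ _ h₁ _ _ h₂ => WittEquiv.tensor h₁ h₂)⟩

/-- Negation in the Witt ring is induced by scaling with `-1`. -/
instance : Neg S.WittRing :=
  ⟨Quotient.map (scale S.negOne) (fun _ _ h => WittEquiv.scale S.negOne h)⟩

instance : CommRing S.WittRing where
  nsmul := nsmulRec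
  zsmul := zsmulRec
  add_assoc := by
    rintro ⟨φ⟩ ⟨ψ⟩ ⟨θ⟩
    exact congrArg S.wittClass (List.append_assoc φ ψ θ)
  zero_add := by
    rintro ⟨φ⟩
    rfl
  add_zero := by
    rintro ⟨φ⟩
    exact congrArg S.wittClass (List.append_nil φ)
  add_comm := by
    rintro ⟨φ⟩ ⟨ψ⟩
    exact wittClass_eq_iff.2 (WittEquiv.of_perm List.perm_append_comm)
  neg_add_cancel := by
    rintro ⟨φ⟩
    exact wittClass_eq_iff.2 (WittEquiv.neg_append φ)
  mul_assoc := by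
    rintro ⟨φ⟩ ⟨ψ⟩ ⟨θ⟩
    exact congrArg S.wittClass (tensor_assoc φ ψ θ)
  mul_comm := by
    rintro ⟨φ⟩ ⟨ψ⟩
    exact wittClass_eq_iff.2 (WittEquiv.of_perm (tensor_comm_perm φ ψ))
  one_mul := by
    rintro ⟨φ⟩
    refine congrArg S.wittClass ?_
    simp [tensor, scale]
  mul_one := by
    rintro ⟨φ⟩
    refine congrArg S.wittClass ?_
    simp [tensor, scale]
  zero_mul := by
    rintro ⟨φ⟩
    refine congrArg S.wittClass ?_
    simp [tensor, scale]
  mul_zero := by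
    rintro ⟨φ⟩
    rfl
  left_distrib := by
    rintro ⟨φ⟩ ⟨ψ⟩ ⟨θ⟩
    exact congrArg S.wittClass (tensor_append φ ψ θ)
  right_distrib := by
    rintro ⟨φ⟩ ⟨ψ⟩ ⟨θ⟩
    refine wittClass_eq_iff.2 (WittEquiv.of_perm ?_)
    refine (tensor_comm_perm _ _).trans ?_
    rw [tensor_append]
    exact (tensor_comm_perm _ _).append (tensor_comm_perm _ _)

theorem wittClass_append (φ ψ : List G) :
    S.wittClass (φ ++ ψ) = S.wittClass φ + S.wittClass ψ := rfl

theorem wittClass_tensor (φ ψ : List G) :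
    S.wittClass (tensor φ ψ) = S.wittClass φ * S.wittClass ψ := rfl

variable (S)

/-- The fundamental ideal `I(S)`: the Witt classes of the even-dimensional forms. -/
def fundamentalIdeal : Ideal S.WittRing where
  carrier := {w | ∃ φ : List G, Even φ.length ∧ S.wittClass φ = w}
  zero_mem' := ⟨[], by simp, rfl⟩
  add_mem' := by
    rintro _ _ ⟨φ, hφ, rfl⟩ ⟨ψ, hψ, rfl⟩
    exact ⟨φ ++ ψ, by rw [List.length_append]; exact hφ.add hψ, rfl⟩
  smul_mem' := by
    rintro ⟨φ⟩ _ ⟨ψ, hψ, rfl⟩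
    exact ⟨tensor φ ψ, by rw [length_tensor]; exact hψ.mul_left _, rfl⟩

theorem wittClass_pfister_pair_mem (a b : G) :
    S.wittClass (S.pfister [a, b]) ∈ S.fundamentalIdeal ^ 2 := by
  have h : ∀ c : G, S.wittClass [1, S.negOne * c] ∈ S.fundamentalIdeal :=
    fun c => ⟨[1, S.negOne * c], by simp, rfl⟩
  have e : S.wittClass (S.pfister [a, b]) =
      S.wittClass [1, S.negOne * a] * (S.wittClass [1, S.negOne * b] * 1) := rfl
  rw [e, mul_one, pow_two]
  exact Ideal.mul_mem_mul (h a) (h b)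

/-- The quotient group `I² / I³`. -/
abbrev SqModCube : Type u :=
  (S.fundamentalIdeal ^ 2).toAddSubgroup ⧸
    ((S.fundamentalIdeal ^ 3).toAddSubgroup.addSubgroupOf (S.fundamentalIdeal ^ 2).toAddSubgroup)

/-- The coset `⟨⟨a, b⟩⟩ + I³` in `I² / I³`. -/
def pfisterCoset (a b : G) : S.SqModCube :=
  QuotientAddGroup.mk ⟨S.wittClass (S.pfister [a, b]), S.wittClass_pfister_pair_mem a b⟩

/-! ### The abstract 2-Brauer group -/

/-- The subgroup of linkage relations `q(a, b) + q(a, c) = q(a, bc)` in the free abelian group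
on `Q`. -/
def linkageRelations : AddSubgroup (FreeAbelianGroup Q) :=
  AddSubgroup.closure {r | ∃ a b c : G,
    r = FreeAbelianGroup.of (S.q a b) + FreeAbelianGroup.of (S.q a c) -
      FreeAbelianGroup.of (S.q a (b * c))}

/-- The abstract 2-Brauer group `B(S)`, written additively: the abelian group generated by the set
of quaternions `Q` with the linkage relations as its sole relations. -/
abbrev BrauerGroup : Type v := FreeAbelianGroup Q ⧸ S.linkageRelations

/-- The element of the abstract 2-Brauer group given by a quaternion. -/
def quaternionClass (x : Q) : S.BrauerGroup := QuotientAddGroup.mk (FreeAbelianGroup.of x)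

end

end QuaternionicStructure

namespace QuaternionicStructure

section

universe u v

variable {G : Type u} {Q : Type v} [CommGroup G] [Zero Q] (S : QuaternionicStructure G Q)

/-! ### The symbol of a pair with values in the abstract 2-Brauer group -/

/-! The homomorphism is built from `B` to `I²/I³`, because `B` is given by generators and relations.
If `q a b = q c d`, linkage passes from one pair to the other by changing one slot at a time, and
each change comes from an isometry of binary forms; so `⟨⟨a, b⟩⟩` depends only on `q a b`
(`pfister_pair_congr`). The identity `⟨⟨a, b⟩⟩ + ⟨⟨a, c⟩⟩ - ⟨⟨a, bc⟩⟩ = ⟨⟨a, b, c⟩⟩` puts the defect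
of the Brauer relations in `I³`. Surjectivity holds because `I` is additively generated by the
classes `1 - ⟨a⟩`, hence `I²` by the 2-fold Pfister classes.

Injectivity needs an invariant that recovers the Brauer class. Dimension, discriminant and Hasse
invariant `∑_{i<j} q(aᵢ, aⱼ)` together become additive in a group structure on `ℤ × G × B` twisted
by the symbol. Isometric forms have equal invariants (`ofForm_congr`), so dividing by the multiples
of the invariant of the hyperbolic plane gives a homomorphism on `W(S)`. It sends `⟨⟨a, b⟩⟩` to the
image of `q(a, b)`, and the identity above shows that it kills `I³`. Since the hyperbolic plane has
dimension `2`, none of its nonzero multiples has dimension `0`, so `B` embeds in the quotient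
(`mk_ofBrauer_injective`). The composite from `B` through `I²/I³` is this embedding, so its first
factor is injective. -/

/-- The class of the quaternion `q(a, b)` in the abstract 2-Brauer group. -/
def symbol (a b : G) : S.BrauerGroup := S.quaternionClass (S.q a b)

theorem symbol_comm (a b : G) : S.symbol a b = S.symbol b a :=
  congrArg S.quaternionClass (S.q_comm a b)

theorem symbol_mul_right (a b c : G) :
    S.symbol a (b * c) = S.symbol a b + S.symbol a c := by
  have h : FreeAbelianGroup.of (S.q a b) + FreeAbelianGroup.of (S.q a c) -
      FreeAbelianGroup.of (S.q a (b * c)) ∈ S.linkageRelations :=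
    AddSubgroup.subset_closure ⟨a, b, c, rfl⟩
  exact (sub_eq_zero.1 ((QuotientAddGroup.eq_zero_iff _).2 h)).symm

theorem symbol_mul_left (a b c : G) :
    S.symbol (a * b) c = S.symbol a c + S.symbol b c := by
  rw [S.symbol_comm, S.symbol_mul_right, S.symbol_comm c a, S.symbol_comm c b]

theorem symbol_one_right (a : G) : S.symbol a 1 = 0 := by
  simpa using S.symbol_mul_right a 1 1

theorem symbol_one_left (a : G) : S.symbol 1 a = 0 := by
  rw [S.symbol_comm, S.symbol_one_right]

/-! ### The group of dimension, discriminant and Hasse invariants -/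

/-- Triples consisting of a dimension, a discriminant and a Hasse invariant. -/
@[ext]
structure InvariantGroup where
  dim : ℤ
  disc : G
  hasse : S.BrauerGroup

variable {S}

namespace InvariantGroup

instance : Zero S.InvariantGroup := ⟨⟨0, 1, 0⟩⟩

/-- The sum reflects the behaviour of the invariants under orthogonal sums of forms. -/
instance : Add S.InvariantGroup :=
  ⟨fun x y => ⟨x.dim + y.dim, x.disc * y.disc, x.hasse + y.hasse + S.symbol x.disc y.disc⟩⟩

/-- A discriminant is its own inverse, so adding `x` to its negative creates the cross term `symbol
x.disc x.disc`, which the Hasse component must cancel. -/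
instance : Neg S.InvariantGroup :=
  ⟨fun x => ⟨-x.dim, x.disc, -x.hasse - S.symbol x.disc x.disc⟩⟩

@[simp] theorem dim_zero : (0 : S.InvariantGroup).dim = 0 := rfl
@[simp] theorem disc_zero : (0 : S.InvariantGroup).disc = 1 := rfl
@[simp] theorem hasse_zero : (0 : S.InvariantGroup).hasse = 0 := rfl
@[simp] theorem dim_add (x y : S.InvariantGroup) : (x + y).dim = x.dim + y.dim := rfl
@[simp] theorem disc_add (x y : S.InvariantGroup) : (x + y).disc = x.disc * y.disc := rfl
@[simp] theorem hasse_add (x y : S.InvariantGroup) :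
    (x + y).hasse = x.hasse + y.hasse + S.symbol x.disc y.disc := rfl
@[simp] theorem disc_neg (x : S.InvariantGroup) : (-x).disc = x.disc := rfl
@[simp] theorem hasse_neg (x : S.InvariantGroup) :
    (-x).hasse = -x.hasse - S.symbol x.disc x.disc := rfl

/-- The symbol is bimultiplicative, hence a 2-cocycle, which gives associativity; its symmetry gives
commutativity. -/
instance : AddCommGroup S.InvariantGroup where
  nsmul := nsmulRec
  zsmul := zsmulRec
  add_assoc x y z := by
    ext
    · exact add_assoc _ _ _
    · exact mul_assoc _ _ _
    · simp only [hasse_add, disc_add, symbol_mul_left, symbol_mul_right]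
      abel
  zero_add x := by ext <;> simp [symbol_one_left]
  add_zero x := by ext <;> simp [symbol_one_right]
  add_comm x y := by
    ext
    · exact add_comm _ _
    · exact mul_comm _ _
    · simp only [hasse_add, S.symbol_comm x.disc, add_comm x.hasse]
  neg_add_cancel x := by
    ext
    · exact neg_add_cancel _
    · exact S.mul_self _
    · simp only [hasse_add, hasse_neg, disc_neg, hasse_zero]
      abel

/-- The invariants of a one-dimensional form. -/
def single (a : G) : S.InvariantGroup := ⟨1, a, 0⟩

/-- The inclusion of the abstract 2-Brauer group as the Hasse invariants of virtual forms of
dimension zero and trivial discriminant. -/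
def ofBrauer : S.BrauerGroup →+ S.InvariantGroup where
  toFun x := ⟨0, 1, x⟩
  map_zero' := rfl
  map_add' x y := by ext <;> simp [symbol_one_left]

theorem single_add_single (a b : G) :
    (single a + single b : S.InvariantGroup) = ⟨2, a * b, S.symbol a b⟩ := by
  ext <;> simp [single]

/-- The left side is the invariant of `⟨⟨a, b⟩⟩ = ⟨1⟩ - ⟨a⟩ - ⟨b⟩ + ⟨ab⟩`. The forms `⟨1, ab⟩` and
`⟨a, b⟩` share dimension and discriminant, so only their Hasse invariants differ. -/
theorem single_one_sub_single_sub_single_add_single_mul (a b : G) :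
    (single 1 - single a - single b + single (a * b) : S.InvariantGroup) =
      ofBrauer (S.symbol a b) := by
  have h : single 1 + single (a * b) =
      ofBrauer (S.symbol a b) + (single a + single b : S.InvariantGroup) := by
    rw [single_add_single, single_add_single]
    ext
    · simp [ofBrauer]
    · simp [ofBrauer]
    · rw [hasse_add]
      change S.symbol 1 (a * b) =
        S.symbol a b + S.symbol a b + S.symbol 1 (a * b)
      -- The symbol is 2-torsion: twice `symbol a b` is `symbol a (b * b) = symbol a 1 = 0`.
      rw [S.symbol_one_left, ← S.symbol_mul_right, S.mul_self, S.symbol_one_right, add_zero]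
  rw [sub_sub, sub_add_eq_add_sub, h, add_sub_cancel_right]

/-! ### Isometry invariance and the hyperbolic plane -/

/-- The invariants of a form. -/
def ofForm (φ : List G) : S.InvariantGroup := (φ.map single).sum

theorem ofForm_append (φ ψ : List G) :
    (ofForm (φ ++ ψ) : S.InvariantGroup) = ofForm φ + ofForm ψ := by
  simp [ofForm]

theorem ofForm_cons (a : G) (φ : List G) :
    (ofForm (a :: φ) : S.InvariantGroup) = single a + ofForm φ := by
  simp [ofForm]

/-- For binary forms, equal determinants and equal values of `q` give equal discriminants and Hasse
invariants. Additivity then carries the equality through the recursive step. -/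
theorem ofForm_congr {φ ψ : List G} (h : S.Isometric φ ψ) :
    (ofForm φ : S.InvariantGroup) = ofForm ψ := by
  induction h with
  | nil => rfl
  | single a => rfl
  | pair hdet hq =>
    simp only [ofForm, List.map_cons, List.map_nil, List.sum_cons, List.sum_nil, add_zero,
      single_add_single, hdet, symbol, hq]
  | step _ _ _ _ h₀ h₁ h₂ =>
    simp only [ofForm_cons] at h₀ h₁ h₂ ⊢
    rw [h₁, h₂, ← add_assoc, ← add_assoc]
    -- Both sides of `h₀` end in the summand `ofForm []`, which is cancelled.
    have h₃ := add_right_cancel ((add_assoc _ _ _).trans (h₀.trans (add_assoc _ _ _).symm))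
    rw [h₃]

variable (S) in
/-- The subgroup generated by the invariants of the hyperbolic plane. -/
def hyperbolicSubgroup : AddSubgroup S.InvariantGroup :=
  AddSubgroup.zmultiples (ofForm S.hyperbolicPlane)

theorem ofForm_hyperbolic_mem (k : ℕ) : ofForm (S.hyperbolic k) ∈ hyperbolicSubgroup S := by
  induction k with
  | zero => exact zero_mem _
  | succ k ih =>
    rw [hyperbolic, ofForm_append]
    exact add_mem (AddSubgroup.mem_zmultiples _) ih

/-- The dimension as a homomorphism. -/
def dimHom : S.InvariantGroup →+ ℤ where
  toFun := dim
  map_zero' := rfl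
  map_add' := dim_add

/-- An element of `B` has dimension `0`, while `n` hyperbolic planes have dimension `2n`; so `n = 0`
when the two coincide. -/
theorem mk_ofBrauer_injective : Function.Injective
    ((QuotientAddGroup.mk' (hyperbolicSubgroup S)).comp ofBrauer) := by
  rw [injective_iff_map_eq_zero]
  intro x hx
  obtain ⟨n, hn⟩ := AddSubgroup.mem_zmultiples_iff.1 ((QuotientAddGroup.eq_zero_iff _).1 hx)
  have hd := congrArg dimHom hn
  rw [map_zsmul] at hd
  change n • (2 : ℤ) = 0 at hd
  have h0 : n = 0 := by simpa using hd
  rw [h0, zero_zsmul] at hn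
  exact (congrArg hasse hn).symm

end InvariantGroup

/-! ### The invariant on the Witt ring -/

open InvariantGroup in
variable (S) in
/-- The invariants of a Witt class, modulo those of the hyperbolic plane. -/
def wittInvariant : S.WittRing →+ S.InvariantGroup ⧸ hyperbolicSubgroup S where
  toFun := Quotient.lift (fun φ => QuotientAddGroup.mk (ofForm φ)) (by
    intro φ ψ h
    obtain ⟨k, l, h⟩ := wittEquiv_iff.1 h
    have h' := congrArg (QuotientAddGroup.mk' (hyperbolicSubgroup S)) (ofForm_congr h)
    have hz : ∀ m, QuotientAddGroup.mk' (hyperbolicSubgroup S) (ofForm (S.hyperbolic m)) = 0 :=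
      fun m => (QuotientAddGroup.eq_zero_iff _).2 (ofForm_hyperbolic_mem m)
    rw [ofForm_append, ofForm_append, map_add, map_add, hz, hz, add_zero, add_zero] at h'
    exact h')
  map_zero' := rfl
  map_add' := by
    rintro ⟨φ⟩ ⟨ψ⟩
    exact congrArg (QuotientAddGroup.mk' (hyperbolicSubgroup S)) (ofForm_append φ ψ)

variable (S) in
/-- The Witt class of the one-dimensional form `⟨a⟩`. -/
def unary (a : G) : S.WittRing := S.wittClass [a]

theorem wittInvariant_unary (a : G) : S.wittInvariant (S.unary a) =
    QuotientAddGroup.mk' (InvariantGroup.hyperbolicSubgroup S) (InvariantGroup.single a) := by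
  refine congrArg (QuotientAddGroup.mk' (InvariantGroup.hyperbolicSubgroup S)) ?_
  simp [InvariantGroup.ofForm]

theorem unary_one : S.unary 1 = 1 := rfl

theorem unary_mul (a b : G) : S.unary (a * b) = S.unary a * S.unary b := by
  -- `tensor [a] [b]` unfolds to `[b * a]`, with the scaling factor on the left.
  rw [mul_comm a b]
  rfl

theorem unary_neg (a : G) : S.unary (S.negOne * a) = -S.unary a := rfl

theorem wittClass_cons (a : G) (φ : List G) :
    S.wittClass (a :: φ) = S.unary a + S.wittClass φ := rfl

theorem wittClass_pair (a b : G) : S.wittClass [a, b] = S.unary a + S.unary b := rfl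

theorem wittClass_pfister_pair (a b : G) :
    S.wittClass (S.pfister [a, b]) = (1 - S.unary a) * (1 - S.unary b) := by
  have e : S.wittClass (S.pfister [a, b]) =
      S.wittClass [1, S.negOne * a] * (S.wittClass [1, S.negOne * b] * 1) := rfl
  rw [e, mul_one, wittClass_pair, wittClass_pair, unary_neg, unary_neg, unary_one,
    ← sub_eq_add_neg, ← sub_eq_add_neg]

/-- Expanding the product gives four unary classes whose signed invariants have dimension `0` and
trivial discriminant, leaving only the symbol. -/
theorem wittInvariant_pfister_pair (a b : G) :
    S.wittInvariant ((1 - S.unary a) * (1 - S.unary b)) =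
      QuotientAddGroup.mk' (InvariantGroup.hyperbolicSubgroup S)
        (InvariantGroup.ofBrauer (S.symbol a b)) := by
  have e : (1 - S.unary a) * (1 - S.unary b) =
      S.unary 1 - S.unary a - S.unary b + S.unary (a * b) := by
    rw [unary_mul, unary_one]
    ring
  rw [e, ← InvariantGroup.single_one_sub_single_sub_single_add_single_mul]
  simp only [map_add, map_sub, wittInvariant_unary]

/-! ### Additive generators of the powers of the fundamental ideal -/

/-- Entries are removed in pairs: since `⟨-a⟩ = -⟨a⟩`, one has `⟨a⟩ + ⟨b⟩ = (1 - ⟨-a⟩) - (1 - ⟨b⟩)`.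
-/
theorem wittClass_mem_closure (φ : List G) (hφ : Even φ.length) :
    S.wittClass φ ∈ AddSubgroup.closure (Set.range fun a => 1 - S.unary a) := by
  match φ with
  | [] => exact zero_mem _
  | [_] => simp at hφ
  | a :: b :: φ =>
    have e : S.wittClass (a :: b :: φ) =
        (1 - S.unary (S.negOne * a)) - (1 - S.unary b) + S.wittClass φ := by
      rw [wittClass_cons, wittClass_cons, unary_neg]
      ring
    rw [e]
    refine add_mem (sub_mem ?_ ?_) (wittClass_mem_closure φ ?_)
    · exact AddSubgroup.subset_closure ⟨_, rfl⟩
    · exact AddSubgroup.subset_closure ⟨_, rfl⟩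
    · simpa [Nat.even_add_one] using hφ

theorem mem_closure_of_mem_fundamentalIdeal {w : S.WittRing} (hw : w ∈ S.fundamentalIdeal) :
    w ∈ AddSubgroup.closure (Set.range fun a => 1 - S.unary a) := by
  obtain ⟨φ, hφ, rfl⟩ := hw
  exact wittClass_mem_closure φ hφ

/-- A product of ideals is additively generated by the products of additive generators. -/
theorem _root_.Ideal.mem_closure_mul_of_mem_mul {R : Type*} [CommRing R] {I J : Ideal R}
    {s t : Set R} (hs : ∀ x ∈ I, x ∈ AddSubgroup.closure s)
    (ht : ∀ x ∈ J, x ∈ AddSubgroup.closure t) {x : R} (hx : x ∈ I * J) :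
    x ∈ AddSubgroup.closure (Set.image2 (· * ·) s t) := by
  refine Submodule.mul_induction_on hx (fun y hy z hz => ?_) fun _ _ => add_mem
  replace hy := hs y hy
  replace hz := ht z hz
  induction hy using AddSubgroup.closure_induction with
  | mem a ha =>
    induction hz using AddSubgroup.closure_induction with
    | mem b hb => exact AddSubgroup.subset_closure ⟨a, ha, b, hb, rfl⟩
    | zero => rw [mul_zero]; exact zero_mem _
    | add _ _ _ _ h₁ h₂ => rw [mul_add]; exact add_mem h₁ h₂
    | neg _ _ h => rw [mul_neg]; exact neg_mem h
  | zero => rw [zero_mul]; exact zero_mem _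
  | add _ _ _ _ h₁ h₂ => rw [add_mul]; exact add_mem h₁ h₂
  | neg _ _ h => rw [neg_mul]; exact neg_mem h

theorem mem_closure_of_mem_fundamentalIdeal_sq {w : S.WittRing}
    (hw : w ∈ S.fundamentalIdeal ^ 2) :
    w ∈ AddSubgroup.closure (Set.image2 (· * ·) (Set.range fun a => 1 - S.unary a)
      (Set.range fun a => 1 - S.unary a)) := by
  rw [pow_two] at hw
  exact Ideal.mem_closure_mul_of_mem_mul (fun _ => mem_closure_of_mem_fundamentalIdeal)
    (fun _ => mem_closure_of_mem_fundamentalIdeal) hw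

theorem one_sub_unary_mem (a : G) : 1 - S.unary a ∈ S.fundamentalIdeal :=
  ⟨[1, S.negOne * a], by simp, by
    rw [wittClass_pair, unary_neg, unary_one, ← sub_eq_add_neg]⟩

theorem one_sub_unary_mul_mem (a b : G) :
    (1 - S.unary a) * (1 - S.unary b) ∈ S.fundamentalIdeal ^ 2 := by
  rw [pow_two]
  exact Ideal.mul_mem_mul (one_sub_unary_mem a) (one_sub_unary_mem b)

/-- Each additive generator `⟨⟨a, b, c⟩⟩` of `I³` is the defect of multiplicativity of `⟨⟨a, ·⟩⟩` at
`b, c`, and the symbol has no such defect. -/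
theorem wittInvariant_eq_zero_of_mem_cube {w : S.WittRing} (hw : w ∈ S.fundamentalIdeal ^ 3) :
    S.wittInvariant w = 0 := by
  rw [pow_succ] at hw
  have h := Ideal.mem_closure_mul_of_mem_mul (fun _ => mem_closure_of_mem_fundamentalIdeal_sq)
    (fun _ => mem_closure_of_mem_fundamentalIdeal) hw
  refine (AddSubgroup.closure_le S.wittInvariant.ker).2 ?_ h
  rintro _ ⟨_, ⟨_, ⟨a, rfl⟩, _, ⟨b, rfl⟩, rfl⟩, _, ⟨c, rfl⟩, rfl⟩
  have e : (1 - S.unary a) * (1 - S.unary b) * (1 - S.unary c) =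
      (1 - S.unary a) * (1 - S.unary b) + (1 - S.unary a) * (1 - S.unary c) -
        (1 - S.unary a) * (1 - S.unary (b * c)) := by
    rw [unary_mul]
    ring
  change S.wittInvariant ((1 - S.unary a) * (1 - S.unary b) * (1 - S.unary c)) = 0
  rw [e, map_sub, map_add, wittInvariant_pfister_pair, wittInvariant_pfister_pair,
    wittInvariant_pfister_pair, symbol_mul_right, map_add, map_add, sub_self]

/-! ### The homomorphism from the abstract 2-Brauer group -/

theorem pfisterCoset_eq_mk (a b : G) : S.pfisterCoset a b =
    QuotientAddGroup.mk ⟨(1 - S.unary a) * (1 - S.unary b), one_sub_unary_mul_mem a b⟩ :=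
  congrArg QuotientAddGroup.mk (Subtype.ext (wittClass_pfister_pair a b))

/-- The hypothesis means `q a (b * c) = 0`, which is the criterion for `⟨b, -ab⟩ ≅ ⟨c, -ac⟩`, both
forms having determinant `-a`. In the Witt ring this says `(1 - ⟨a⟩)⟨b⟩ = (1 - ⟨a⟩)⟨c⟩`. -/
theorem pfister_pair_congr_right {a b c : G} (h : S.q a b = S.q a c) :
    (1 - S.unary a) * (1 - S.unary b) = (1 - S.unary a) * (1 - S.unary c) := by
  have hi : S.Isometric [b, S.negOne * (a * b)] [c, S.negOne * (a * c)] := by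
    refine Isometric.pair_iff_zero.2 ⟨?_, ?_⟩
    · simp only [mul_comm, mul_left_comm, S.mul_self_left]
    · have e : S.negOne * (b * (S.negOne * (a * b))) = a := by
        simp only [mul_comm, mul_left_comm, S.mul_self_left, S.mul_self, mul_one]
      rw [e]
      exact (S.q_eq_iff a b c).1 h
  have hw : S.wittClass [b, S.negOne * (a * b)] = S.wittClass [c, S.negOne * (a * c)] :=
    wittClass_eq_iff.2 (WittEquiv.of_isometric hi)
  rw [wittClass_pair, wittClass_pair, unary_neg, unary_neg, unary_mul, unary_mul] at hw
  linear_combination -hw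

/-- Linkage supplies the chain `(a, b)`, `(a, x)`, `(c, x)`, `(c, d)`, in which each move changes a
single slot. -/
theorem pfister_pair_congr {a b c d : G} (h : S.q a b = S.q c d) :
    (1 - S.unary a) * (1 - S.unary b) = (1 - S.unary c) * (1 - S.unary d) := by
  obtain ⟨x, h₁, h₂, h₃⟩ := (S.q_linked a b c d).1 h
  rw [S.q_comm a x, S.q_comm c x] at h₂
  rw [pfister_pair_congr_right h₁, mul_comm, pfister_pair_congr_right h₂, mul_comm,
    pfister_pair_congr_right h₃]

theorem pfisterCoset_congr {a b c d : G} (h : S.q a b = S.q c d) :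
    S.pfisterCoset a b = S.pfisterCoset c d := by
  rw [pfisterCoset_eq_mk, pfisterCoset_eq_mk]
  exact congrArg QuotientAddGroup.mk (Subtype.ext (pfister_pair_congr h))

theorem pfisterCoset_mul_right (a b c : G) :
    S.pfisterCoset a (b * c) = S.pfisterCoset a b + S.pfisterCoset a c := by
  rw [pfisterCoset_eq_mk, pfisterCoset_eq_mk, pfisterCoset_eq_mk, ← QuotientAddGroup.mk_add,
    QuotientAddGroup.eq]
  change -((1 - S.unary a) * (1 - S.unary (b * c))) +
    ((1 - S.unary a) * (1 - S.unary b) + (1 - S.unary a) * (1 - S.unary c)) ∈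
      S.fundamentalIdeal ^ 3
  have e : -((1 - S.unary a) * (1 - S.unary (b * c))) +
      ((1 - S.unary a) * (1 - S.unary b) + (1 - S.unary a) * (1 - S.unary c)) =
      (1 - S.unary a) * (1 - S.unary b) * (1 - S.unary c) := by
    rw [unary_mul]
    ring
  rw [e, pow_succ]
  exact Ideal.mul_mem_mul (one_sub_unary_mul_mem a b) (one_sub_unary_mem c)

variable (S) in
/-- The homomorphism from the abstract 2-Brauer group to `I² / I³` that sends the class of
`q(a, b)` to the coset of `⟨⟨a, b⟩⟩`. -/
noncomputable def brauerToSqModCube : S.BrauerGroup →+ S.SqModCube :=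
  QuotientAddGroup.lift S.linkageRelations
    (FreeAbelianGroup.lift fun x =>
      S.pfisterCoset (S.q_surjective x).choose.1 (S.q_surjective x).choose.2) (by
    -- The chosen representation of a quaternion as `q a b` does not affect the coset.
    have key : ∀ a b : G, S.pfisterCoset (S.q_surjective (S.q a b)).choose.1
        (S.q_surjective (S.q a b)).choose.2 = S.pfisterCoset a b :=
      fun a b => pfisterCoset_congr (S.q_surjective (S.q a b)).choose_spec
    refine (AddSubgroup.closure_le _).2 ?_
    rintro _ ⟨a, b, c, rfl⟩
    rw [SetLike.mem_coe, AddMonoidHom.mem_ker, map_sub, map_add, FreeAbelianGroup.lift_apply_of,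
      FreeAbelianGroup.lift_apply_of, FreeAbelianGroup.lift_apply_of, key, key, key,
      pfisterCoset_mul_right, sub_self])

theorem brauerToSqModCube_symbol (a b : G) :
    S.brauerToSqModCube (S.symbol a b) = S.pfisterCoset a b := by
  refine (FreeAbelianGroup.lift_apply_of _ _).trans ?_
  exact pfisterCoset_congr (S.q_surjective (S.q a b)).choose_spec

/-! ### Surjectivity -/

variable (S) in
theorem brauerToSqModCube_surjective : Function.Surjective S.brauerToSqModCube := by
  -- Membership in `I²` is part of the conclusion because the coset of `w` can be formed only with
  -- it, and the closure induction has to supply it at each stage.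
  suffices h : ∀ w ∈ AddSubgroup.closure (Set.image2 (· * ·)
      (Set.range fun a => 1 - S.unary a) (Set.range fun a => 1 - S.unary a)),
      ∃ (hw : w ∈ S.fundamentalIdeal ^ 2) (x : S.BrauerGroup),
        S.brauerToSqModCube x = QuotientAddGroup.mk ⟨w, hw⟩ by
    intro y
    obtain ⟨⟨w, hw⟩, rfl⟩ := QuotientAddGroup.mk_surjective y
    exact (h w (mem_closure_of_mem_fundamentalIdeal_sq hw)).2
  intro w hw
  induction hw using AddSubgroup.closure_induction with
  | mem w hw =>
    obtain ⟨_, ⟨a, rfl⟩, _, ⟨b, rfl⟩, rfl⟩ := hw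
    exact ⟨one_sub_unary_mul_mem a b, S.symbol a b,
      (brauerToSqModCube_symbol a b).trans (pfisterCoset_eq_mk a b)⟩
  | zero => exact ⟨zero_mem _, 0, map_zero _⟩
  | add w w' _ _ h h' =>
    obtain ⟨hw, x, hx⟩ := h
    obtain ⟨hw', x', hx'⟩ := h'
    exact ⟨add_mem hw hw', x + x', by rw [map_add, hx, hx']; rfl⟩
  | neg w _ h =>
    obtain ⟨hw, x, hx⟩ := h
    exact ⟨neg_mem hw, -x, by rw [map_neg, hx]; rfl⟩

/-! ### Injectivity through the invariants -/

variable (S) in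
/-- The invariants of a class in `I² / I³`, modulo those of the hyperbolic plane. -/
def sqModCubeInvariant :
    S.SqModCube →+ S.InvariantGroup ⧸ InvariantGroup.hyperbolicSubgroup S :=
  QuotientAddGroup.lift _
    (S.wittInvariant.comp (S.fundamentalIdeal ^ 2).toAddSubgroup.subtype)
    fun _ hw => wittInvariant_eq_zero_of_mem_cube hw

-- Both homomorphisms send the generator `q(a, b)` to the class of `(0, 1, q(a, b))`, and every
-- quaternion has the form `q(a, b)`.
variable (S) in
theorem sqModCubeInvariant_comp_brauerToSqModCube :
    S.sqModCubeInvariant.comp S.brauerToSqModCube =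
      (QuotientAddGroup.mk' (InvariantGroup.hyperbolicSubgroup S)).comp
        InvariantGroup.ofBrauer := by
  refine QuotientAddGroup.addMonoidHom_ext _ (FreeAbelianGroup.lift_ext _ _ fun x => ?_)
  obtain ⟨⟨a, b⟩, rfl⟩ := S.q_surjective x
  change S.sqModCubeInvariant (S.brauerToSqModCube (S.symbol a b)) = _
  rw [brauerToSqModCube_symbol, pfisterCoset_eq_mk]
  exact wittInvariant_pfister_pair a b

variable (S) in
theorem brauerToSqModCube_injective : Function.Injective S.brauerToSqModCube := by
  have h : Function.Injective (S.sqModCubeInvariant.comp S.brauerToSqModCube) := by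
    rw [sqModCubeInvariant_comp_brauerToSqModCube]
    exact InvariantGroup.mk_ofBrauer_injective
  exact Function.Injective.of_comp h

end

end QuaternionicStructure

/-! ### The isomorphism -/

theorem mainTheorem3 {G : Type*} {Q : Type*} [CommGroup G] [Zero Q]
    (S : QuaternionicStructure G Q) :
    ∃ e : S.SqModCube ≃+ S.BrauerGroup,
      ∀ a b : G, e (S.pfisterCoset a b) = S.quaternionClass (S.q a b) := by
  refine ⟨(AddEquiv.ofBijective S.brauerToSqModCube
    ⟨S.brauerToSqModCube_injective, S.brauerToSqModCube_surjective⟩).symm, fun a b => ?_⟩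
  rw [AddEquiv.symm_apply_eq]
  exact (QuaternionicStructure.brauerToSqModCube_symbol a b).symm
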